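/- Let $N$ agents communicate over time-varying directed graphs $G(t)=(\{1,\dots,N\},\mathcal E(t))$, $t=0,1,2,\dots$, with $\mathcal N_i(t)=\{j\ne i:(i,j)\in\mathcal E(t)\}$ and real weights $a_{ij}(t)$. Let $\mathcal P(t)$ be the $N\times N$ matrix with $\mathcal P_{ij}(t)=a_{ij}(t)$ for $j\in\mathcal N_i(t)$, $\mathcal P_{ii}(t)=1-\sum_{j\in\mathcal N_i(t)}a_{ij}(t)$, and all other entries $0$. Assume that for some constant $\bar a>0$ and all $t$ the entries of $\mathcal P(t)$ are at most $1$, and that $\mathcal P_{ij}(t)>\bar a$ whenever $j=i$ or $j\in\mathcal N_i(t)$. Assume moreover: (A1) $G(t)$ is uniformly strongly connected: there is an integer $T>0$ such that for every $t\ge 0$ the graph with edge set $\bigcup_{k=t}^{t+T}\mathcal E(k)$ is strongly connected; (A6) $S=\begin{pmatrix}1&h\\0&1\end{pmatrix}$ with $h>0$; (A10) $\bigcap_i W^i_\epsilon\neq\emptyset$, where $\epsilon>0$ and each $W^i_\epsilon\subseteq\mathbb R^2$ is a truncated set of admissible references, that is, $W^i_\epsilon=\{(\omega^1,\omega^2):\tilde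 H^i_\omega\,\omega^2\le (1-\epsilon)\mathbf 1\}$ (row by row) for some vector $\tilde H^i_\omega\in\mathbb R^{\ell_i}$, or $W^i_\epsilon=\{(\omega^1,\omega^2):\underline{\omega_i^2}+\epsilon\le\omega^2\le\overline{\omega_i^2}-\epsilon\}$ for some real bounds $\underline{\omega_i^2},\overline{\omega_i^2}$. Let $\mathrm{Proj}_W(\mu)=\arg\min\{\|\mu-\omega\|^2:\omega\in W\}$ with the Euclidean norm, and, from arbitrary initial values $\omega_i(0)\in\mathbb R^2$, let $$\omega_i(t+1)=\mathrm{Proj}_{W^i_\epsilon}\Big(S\big(\omega_i(t)+\sum_{j\in\mathcal N_i(t)}a_{ij}(t)(\omega_j(t)-\omega_i(t))\big)\Big),\qquad t\ge 0,\ i=1,\dots,N.$$ Then the $\omega_i(t)$ reach consensus on a trajectory of the reference model inside all the sets: there is a sequence $\bar\omega(t)$ with $\bar\omega(t+1)=S\bar\omega(t)$ and $\bar\omega(t)\in\bigcap_i W^i_\epsilon$ for all $t\ge0$, such that $\lim_{t\to\infty}\big(\omega_i(t)-\bar\omega(t)\big)=0$ for every $i$. -/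

import Mathlib

open Filter Topology

noncomputable section

/-- The plane in which the references live, with its Euclidean norm.
Coordinate `0` is `ω¹`, coordinate `1` is `ω²`. -/
abbrev RefSpace : Type := EuclideanSpace ℝ (Fin 2)

/-- The reference model `S = [1 h; 0 1]`, acting on the plane. -/
def refModel (h : ℝ) : RefSpace →ₗ[ℝ] RefSpace :=
  Matrix.toEuclideanLin !![1, h; 0, 1]

/-- The neighbours `{j : (i,j) ∈ E, i ≠ j}` of node `i` in the directed graph with edge set `E`. -/
def neighbors {N : ℕ} (E : Set (Fin N × Fin N)) (i : Fin N) : Finset (Fin N) :=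
  open Classical in Finset.univ.filter (fun j => (i, j) ∈ E ∧ i ≠ j)

/-- The matrix `P(G)` of the weighted graph with edge set `E` and weights `a`. -/
def commMatrix {N : ℕ} (E : Set (Fin N × Fin N)) (a : Fin N → Fin N → ℝ) :
    Matrix (Fin N) (Fin N) ℝ :=
  open Classical in Matrix.of fun i j =>
    if i = j then 1 - ∑ k ∈ neighbors E i, a i k
    else if (i, j) ∈ E then a i j
    else 0

/-- The standing condition on the weights: all entries of `P(G(t))` are at most `1`, and those
carried by an edge of `G(t)`, as well as the diagonal ones, exceed the constant `abar`. -/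
def WeightsBounded {N : ℕ} (E : ℕ → Set (Fin N × Fin N)) (a : ℕ → Fin N → Fin N → ℝ)
    (abar : ℝ) : Prop :=
  ∀ t i j, commMatrix (E t) (a t) i j ≤ 1 ∧
    ((i, j) ∈ E t ∨ i = j → abar < commMatrix (E t) (a t) i j)

/-- Between any two nodes there is a directed path. -/
def StronglyConnected {N : ℕ} (E : Set (Fin N × Fin N)) : Prop :=
  ∀ i j, Relation.ReflTransGen (fun u v => (u, v) ∈ E) i j

/-- Uniform strong connectivity of a time-varying directed graph. -/
def UniformlyStronglyConnected {N : ℕ} (E : ℕ → Set (Fin N × Fin N)) : Prop :=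
  ∃ T : ℕ, 0 < T ∧ ∀ t, StronglyConnected (⋃ k ∈ Set.Icc t (t + T), E k)

/-- The set `{(ω¹, ω²) : Hw ω² ≤ 1 - ε}`, the inequality being read row by row. -/
def refSetOfRows (ε : ℝ) {l : ℕ} (Hw : Fin l → ℝ) : Set RefSpace :=
  {w | ∀ k, Hw k * w 1 ≤ 1 - ε}

/-- The set `{(ω¹, ω²) : lo + ε ≤ ω² ≤ up - ε}`. -/
def refSetOfBounds (ε lo up : ℝ) : Set RefSpace :=
  {w | lo + ε ≤ w 1 ∧ w 1 ≤ up - ε}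

/-- `W` is a truncated set of admissible references: it has one of the two forms above.
(With the same `ε` the two forms are in general different sets, so both are allowed.) -/
def IsTruncatedRefSet (ε : ℝ) (W : Set RefSpace) : Prop :=
  (∃ (l : ℕ) (Hw : Fin l → ℝ), W = refSetOfRows ε Hw) ∨
    ∃ lo up : ℝ, W = refSetOfBounds ε lo up

/-- `p = Proj_W(μ) = argmin {‖μ - w‖² : w ∈ W}`. -/
def IsProj (W : Set RefSpace) (μ p : RefSpace) : Prop :=
  p ∈ W ∧ IsMinOn (fun w => ‖μ - w‖ ^ 2) W p

end

/-!
The sets `W i` only constrain the second coordinate, to a closed interval `I i`, and the second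
coordinate is fixed by `S`. With `P t` the row-stochastic matrix of the weights, the two
coordinates `x`, `v` of the agents therefore satisfy
`v (t + 1) i = proj (I i) ((P t v) i)` and `x (t + 1) = P t x + h • P t v`.

*Second coordinate.* On the bounded range visited by `v` the intervals may be taken compact,
`I i = [lo i, hi i]`. The number `U = maxᵢ max (v i) (lo i)` never increases and
`L = minᵢ min (v i) (hi i)` never decreases. The midpoint of `[L, U]` cannot lie both strictly
below some `lo i` and strictly above some `hi j`; if, say, it lies above all `lo i`, then after
one step some agent is below `U` by a fixed fraction of `U - L`, and connectivity spreads this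
to all agents within a bounded time (`ConsensusWeights.spread`), so that `U` decreases by a fixed
fraction of `U - L`. Hence `U - L` contracts by a constant factor over windows of fixed length,
and `v` converges to a common value `vbar` in all the intervals, with summable error
(`ConsensusWeights.exists_constrained_consensus`).

*First coordinate.* `z t i = x t i - h * t * vbar` obeys `z (t + 1) = P t z` up to a summable
error. Adding to (subtracting from) `z` a tail of the error bounds makes its maximum nonincreasing
(its minimum nondecreasing), and the spreading argument makes the two meet in the limit
(`ConsensusWeights.exists_perturbed_consensus`).
-/

open Filter Topology

/-! ### Sequences -/

theorem tendsto_zero_of_antitone_of_contracting {D c : ℕ → ℝ} (hD : Antitone D)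
    (hD0 : ∀ t, 0 ≤ D t) {q : ℝ} (hq : q < 1) {K : ℕ} (hK : ∀ t, D (t + K) ≤ q * D t + c t)
    (hc : Tendsto c atTop (𝓝 0)) : Tendsto D atTop (𝓝 0) := by
  have hlim := tendsto_atTop_ciInf hD ⟨0, by rintro _ ⟨t, rfl⟩; exact hD0 t⟩
  set d := ⨅ t, D t
  have hd : 0 ≤ d := ge_of_tendsto' hlim hD0
  have h1 : d ≤ q * d + 0 :=
    le_of_tendsto_of_tendsto' (hlim.comp (tendsto_add_atTop_nat K))
      ((hlim.const_mul q).add hc) hK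
  have : d = 0 := by nlinarith
  rwa [this] at hlim

/-! ### Averaging over uniformly strongly connected graphs -/

/-- `P t` are row-stochastic matrices, with entries at least `α > 0` on the diagonal and along the
edges of `E t`, and the union of any `T + 1` consecutive edge sets is strongly connected. -/
structure ConsensusWeights {N : ℕ} (E : ℕ → Set (Fin N × Fin N))
    (P : ℕ → Matrix (Fin N) (Fin N) ℝ) (α : ℝ) (T : ℕ) : Prop where
  pos : 0 < α
  le_one : α ≤ 1
  nonneg : ∀ t i j, 0 ≤ P t i j
  row_sum : ∀ t i, ∑ j, P t i j = 1
  le_diag : ∀ t i, α ≤ P t i i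
  le_edge : ∀ t i j, (i, j) ∈ E t → α ≤ P t i j
  conn : ∀ t, StronglyConnected (⋃ k ∈ Set.Icc t (t + T), E k)

namespace ConsensusWeights

variable {N : ℕ} {E : ℕ → Set (Fin N × Fin N)} {P : ℕ → Matrix (Fin N) (Fin N) ℝ} {α : ℝ} {T : ℕ}

theorem sum_const (hP : ConsensusWeights E P α T) (t : ℕ) (i : Fin N) (c : ℝ) :
    ∑ j, P t i j * c = c := by
  rw [← Finset.sum_mul, hP.row_sum, one_mul]

theorem sum_le (hP : ConsensusWeights E P α T) (t : ℕ) (i : Fin N) {u : Fin N → ℝ} {U : ℝ}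
    (hU : ∀ j, u j ≤ U) : ∑ j, P t i j * u j ≤ U :=
  (Finset.sum_le_sum fun j _ => mul_le_mul_of_nonneg_left (hU j) (hP.nonneg t i j)).trans_eq
    (hP.sum_const t i U)

theorem le_sum (hP : ConsensusWeights E P α T) (t : ℕ) (i : Fin N) {u : Fin N → ℝ} {L : ℝ}
    (hL : ∀ j, L ≤ u j) : L ≤ ∑ j, P t i j * u j :=
  (hP.sum_const t i L).symm.trans_le
    (Finset.sum_le_sum fun j _ => mul_le_mul_of_nonneg_left (hL j) (hP.nonneg t i j))

theorem sum_le_sub (hP : ConsensusWeights E P α T) {t : ℕ} {i j : Fin N} {u : Fin N → ℝ} {U δ : ℝ}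
    (hδ : 0 ≤ δ) (hU : ∀ j, u j ≤ U) (hij : α ≤ P t i j) (hj : u j ≤ U - δ) :
    ∑ k, P t i k * u k ≤ U - α * δ := by
  have h1 : P t i j * (U - u j) ≤ ∑ k, P t i k * (U - u k) :=
    Finset.single_le_sum (f := fun k => P t i k * (U - u k))
      (fun k _ => mul_nonneg (hP.nonneg t i k) (sub_nonneg.2 (hU k))) (Finset.mem_univ j)
  have h2 : ∑ k, P t i k * (U - u k) = U - ∑ k, P t i k * u k := by
    simp_rw [mul_sub, Finset.sum_sub_distrib, hP.sum_const]
  have h3 : α * δ ≤ P t i j * (U - u j) :=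
    mul_le_mul hij (by linarith) hδ (hP.nonneg t i j)
  linarith

/-- If all agents are at most `U` and one of them is at most `U - δ`, then after `(T + 1) * N`
averaging steps all agents have fallen below `U` by a fixed fraction of `δ`. The floors `ℓ i`,
which may hold an agent up, do not interfere as long as they are at most `U - δ`. -/
theorem spread (hP : ConsensusWeights E P α T) {u : ℕ → Fin N → ℝ} {ℓ : Fin N → ℝ}
    (hu : ∀ t i, u (t + 1) i ≤ max (∑ j, P t i j * u t j) (ℓ i)) {t : ℕ} {U δ : ℝ} (hδ : 0 ≤ δ)
    (hU : ∀ i, u t i ≤ U) (hℓ : ∀ i, ℓ i ≤ U - δ) (hex : ∃ i, u t i ≤ U - δ) (i : Fin N) :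
    u (t + (T + 1) * N) i ≤ U - α ^ ((T + 1) * N) * δ := by
  classical
  have hpow : ∀ s, 0 ≤ α ^ s * δ := fun s => mul_nonneg (pow_nonneg hP.pos.le s) hδ
  have hpow1 : ∀ s, α ^ s * δ ≤ δ := fun s =>
    mul_le_of_le_one_left hδ (pow_le_one₀ hP.pos.le hP.le_one)
  have hUs : ∀ s i, u (t + s) i ≤ U := by
    intro s
    induction s with
    | zero => exact hU
    | succ s ih =>
      exact fun i => (hu (t + s) i).trans
        (max_le (hP.sum_le _ i ih) ((hℓ i).trans (sub_le_self _ hδ)))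
  -- the agents that have fallen by `α ^ s * δ` after `s` steps
  let A : ℕ → Finset (Fin N) := fun s => {i | u (t + s) i ≤ U - α ^ s * δ}
  have hA : ∀ s i, i ∈ A s ↔ u (t + s) i ≤ U - α ^ s * δ := fun s i => by simp [A]
  have hstep : ∀ s i j, α ≤ P (t + s) i j → j ∈ A s → i ∈ A (s + 1) := by
    intro s i j hij hj
    rw [hA] at hj ⊢
    refine (hu (t + s) i).trans (max_le ?_ ((hℓ i).trans (sub_le_sub_left (hpow1 _) _)))
    have := hP.sum_le_sub (hpow s) (hUs s) hij hj
    rwa [← mul_assoc, ← pow_succ'] at this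
  have hmono : Monotone A := monotone_nat_of_le_succ fun s i hi =>
    hstep s i i (hP.le_diag _ i) hi
  have hcard : ∀ n, min N (n + 1) ≤ (A ((T + 1) * n)).card := by
    intro n
    induction n with
    | zero =>
      obtain ⟨i, hi⟩ := hex
      exact (min_le_right _ _).trans (Finset.card_pos.2 ⟨i, by simpa [hA] using hi⟩)
    | succ n ih =>
      by_cases hall : A ((T + 1) * n) = Finset.univ
      · have : A ((T + 1) * (n + 1)) = Finset.univ :=
          Finset.univ_subset_iff.1 (hall ▸ hmono (by gcongr; omega))
        simp [this]
      · obtain ⟨i, hi⟩ : ∃ i, i ∉ A ((T + 1) * n) := by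
          by_contra! hcon
          exact hall (Finset.eq_univ_iff_forall.2 hcon)
        have hpos : 0 < (A ((T + 1) * n)).card := by
          have := i.pos
          omega
        obtain ⟨j, hj⟩ := Finset.card_pos.1 hpos
        -- a path from outside `A` into `A` has an edge that enters `A`
        have hcross : ∃ k l, k ∉ A ((T + 1) * n) ∧ l ∈ A ((T + 1) * n) ∧
            (k, l) ∈ ⋃ s ∈ Set.Icc (t + (T + 1) * n) (t + (T + 1) * n + T), E s := by
          by_contra! hcon
          have hout : ∀ k, Relation.ReflTransGen (fun u v => (u, v) ∈
              ⋃ s ∈ Set.Icc (t + (T + 1) * n) (t + (T + 1) * n + T), E s) i k →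
              k ∉ A ((T + 1) * n) := by
            intro k hk
            induction hk with
            | refl => exact hi
            | tail _ hkl ih' => exact fun hl => hcon _ _ ih' hl hkl
          exact hout j (hP.conn _ i j) hj
        obtain ⟨k, l, hk, hl, hkl⟩ := hcross
        simp only [Set.mem_iUnion, Set.mem_Icc] at hkl
        obtain ⟨s, ⟨hs1, hs2⟩, hs⟩ := hkl
        obtain ⟨r, rfl⟩ := Nat.exists_eq_add_of_le hs1
        have hk' : k ∈ A ((T + 1) * n + r + 1) := by
          refine hstep _ k l ?_ (hmono (Nat.le_add_right _ _) hl)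
          rw [← add_assoc]
          exact hP.le_edge _ _ _ hs
        have hlt : A ((T + 1) * n) ⊂ A ((T + 1) * (n + 1)) := by
          refine (Finset.ssubset_iff_of_subset (hmono (by gcongr; omega))).2 ⟨k, ?_, hk⟩
          exact hmono (by rw [mul_add]; omega) hk'
        have := Finset.card_lt_card hlt
        omega
  have huniv : A ((T + 1) * N) = Finset.univ := by
    rw [← Finset.card_eq_iff_eq_univ, Fintype.card_fin]
    refine le_antisymm (by simpa using (A ((T + 1) * N)).card_le_univ) ?_
    simpa using hcard N
  exact (hA _ _).1 (huniv ▸ Finset.mem_univ i)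

/-! ### Consensus under interval constraints -/

/-- If all floors `lo i` are below `U` by `δ`, and some agent either is itself below `U` by `δ` or
is forced there by its ceiling `hi i`, then all agents fall by a fixed fraction of `δ`. -/
theorem spread_of_ceiling (hP : ConsensusWeights E P α T) {v : ℕ → Fin N → ℝ} {lo hi : Fin N → ℝ}
    (hup : ∀ t i, v (t + 1) i ≤ max (∑ j, P t i j * v t j) (lo i))
    (hhi : ∀ t i, v (t + 1) i ≤ hi i) {t : ℕ} {U δ : ℝ} (hδ : 0 ≤ δ) (hU : ∀ i, v t i ≤ U)
    (hlo : ∀ i, lo i ≤ U - δ) (hex : ∃ i, min (v t i) (hi i) ≤ U - δ) (i : Fin N) :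
    v (t + ((T + 1) * N + 1)) i ≤ U - α ^ ((T + 1) * N + 1) * δ := by
  have hαδ : α * δ ≤ δ := mul_le_of_le_one_left hδ hP.le_one
  have hU1 : ∀ i, v (t + 1) i ≤ U := fun i => (hup t i).trans
    (max_le (hP.sum_le t i hU) ((hlo i).trans (sub_le_self _ hδ)))
  have hex1 : ∃ i, v (t + 1) i ≤ U - α * δ := by
    obtain ⟨i, h⟩ := hex
    refine ⟨i, ?_⟩
    rcases min_le_iff.1 h with h | h
    · exact (hup t i).trans (max_le (hP.sum_le_sub hδ hU (hP.le_diag t i) h)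
        ((hlo i).trans (by linarith)))
    · exact (hhi t i).trans (h.trans (by linarith))
  have := hP.spread hup (mul_nonneg hP.pos.le hδ) hU1 (fun i => (hlo i).trans (by linarith)) hex1 i
  rwa [← mul_assoc, ← pow_succ, add_assoc, add_comm 1] at this

/-- Agents that average and then clip to compact intervals `[lo i, hi i]` with a common point
converge to a common value in all the intervals, with an error bound `D` that contracts by a
constant factor over windows of fixed length. -/
theorem exists_constrained_consensus [Nonempty (Fin N)] (hP : ConsensusWeights E P α T)
    {v : ℕ → Fin N → ℝ} {lo hi : Fin N → ℝ} (hlohi : ∀ i j, lo i ≤ hi j)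
    (hup : ∀ t i, v (t + 1) i ≤ max (∑ j, P t i j * v t j) (lo i))
    (hdown : ∀ t i, min (∑ j, P t i j * v t j) (hi i) ≤ v (t + 1) i)
    (hmem : ∀ t i, v (t + 1) i ∈ Set.Icc (lo i) (hi i)) :
    ∃ x, (∀ i, x ∈ Set.Icc (lo i) (hi i)) ∧ ∃ (D : ℕ → ℝ) (q : ℝ) (K : ℕ), Antitone D ∧
      (∀ t, 0 ≤ D t) ∧ q < 1 ∧ (∀ t, D (t + K) ≤ q * D t) ∧ ∀ t i, |v t i - x| ≤ D t := by
  let U : ℕ → ℝ := fun t => Finset.univ.sup' Finset.univ_nonempty fun i => max (v t i) (lo i)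
  let L : ℕ → ℝ := fun t => Finset.univ.inf' Finset.univ_nonempty fun i => min (v t i) (hi i)
  have hU : ∀ t i, max (v t i) (lo i) ≤ U t := fun t i =>
    Finset.le_sup' (fun i => max (v t i) (lo i)) (Finset.mem_univ i)
  have hL : ∀ t i, L t ≤ min (v t i) (hi i) := fun t i =>
    Finset.inf'_le (fun i => min (v t i) (hi i)) (Finset.mem_univ i)
  have hvU : ∀ t i, v t i ≤ U t := fun t i => (le_max_left _ _).trans (hU t i)
  have hloU : ∀ t i, lo i ≤ U t := fun t i => (le_max_right _ _).trans (hU t i)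
  have hLv : ∀ t i, L t ≤ v t i := fun t i => (hL t i).trans (min_le_left _ _)
  have hLhi : ∀ t i, L t ≤ hi i := fun t i => (hL t i).trans (min_le_right _ _)
  have hUle : ∀ t B, (∀ i, v t i ≤ B) → (∀ i, lo i ≤ B) → U t ≤ B := fun t B h1 h2 =>
    Finset.sup'_le _ _ fun i _ => max_le (h1 i) (h2 i)
  have hleL : ∀ t B, (∀ i, B ≤ v t i) → (∀ i, B ≤ hi i) → B ≤ L t := fun t B h1 h2 =>
    Finset.le_inf' _ _ fun i _ => le_min (h1 i) (h2 i)
  have hLU : ∀ t, L t ≤ U t := fun t =>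
    (hLv t (Classical.arbitrary _)).trans (hvU t (Classical.arbitrary _))
  have hUanti : Antitone U := antitone_nat_of_succ_le fun t => hUle _ _
    (fun i => (hup t i).trans (max_le (hP.sum_le t i (hvU t)) (hloU t i))) (hloU t)
  have hLmono : Monotone L := monotone_nat_of_le_succ fun t => hleL _ _
    (fun i => (le_min (hP.le_sum t i (hLv t)) (hLhi t i)).trans (hdown t i)) (hLhi t)
  set K := (T + 1) * N + 1 with hK
  have hα0 : 0 < α ^ K := pow_pos hP.pos K
  have hα1 : α ^ K ≤ 1 := pow_le_one₀ hP.pos.le hP.le_one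
  have hcontr : ∀ t, U (t + K) - L (t + K) ≤ (1 - α ^ K / 2) * (U t - L t) := by
    intro t
    have hδ : 0 ≤ (U t - L t) / 2 := by linarith [hLU t]
    have hαδ : α ^ K * ((U t - L t) / 2) ≤ (U t - L t) / 2 := mul_le_of_le_one_left hδ hα1
    by_cases hmid : ∀ i, lo i ≤ U t - (U t - L t) / 2
    · obtain ⟨i, -, hi'⟩ := Finset.exists_mem_eq_inf' Finset.univ_nonempty
        fun i => min (v t i) (hi i)
      have h1 := hUle (t + K) _ (hP.spread_of_ceiling hup (fun t i => (hmem t i).2) hδ (hvU t) hmid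
        ⟨i, hi'.symm.trans_le (by change L t ≤ _; linarith)⟩)
        (fun i => (hmid i).trans (by linarith))
      have h2 := hLmono (Nat.le_add_right t K)
      linarith
    · push Not at hmid
      obtain ⟨k, hk⟩ := hmid
      obtain ⟨i, -, hi'⟩ := Finset.exists_mem_eq_sup' Finset.univ_nonempty
        fun i => max (v t i) (lo i)
      -- the mirror image: negate the agents and exchange floors and ceilings
      have h1 := hP.spread_of_ceiling (v := fun t i => -v t i) (lo := fun i => -hi i)
        (hi := fun i => -lo i) (t := t) (U := -L t) (δ := (U t - L t) / 2)
        (fun t i => by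
          simp only [mul_neg, Finset.sum_neg_distrib, max_neg_neg]
          exact neg_le_neg (hdown t i))
        (fun t i => neg_le_neg (hmem t i).1) hδ (fun i => neg_le_neg (hLv t i))
        (fun i => by linarith [hlohi k i])
        ⟨i, by
          rw [min_neg_neg, ← hi']
          change -U t ≤ _
          linarith⟩
      have h2 := hleL (t + K) (L t + α ^ K * ((U t - L t) / 2))
        (fun i => by linarith [h1 i]) (fun i => by linarith [hlohi k i])
      have h3 := hUanti (Nat.le_add_right t K)
      linarith
  have hDanti : Antitone fun t => U t - L t := fun s t hst =>
    sub_le_sub (hUanti hst) (hLmono hst)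
  have hD0 : ∀ t, 0 ≤ U t - L t := fun t => sub_nonneg.2 (hLU t)
  have hx : ∀ t, (⨆ t, L t) ∈ Set.Icc (L t) (U t) := by
    simpa using hLmono.ciSup_mem_iInter_Icc_of_antitone hUanti hLU
  have hDlim := tendsto_zero_of_antitone_of_contracting hDanti hD0 (q := 1 - α ^ K / 2)
    (by linarith) (fun t => (hcontr t).trans_eq (add_zero _).symm) tendsto_const_nhds
  refine ⟨⨆ t, L t, fun i => ⟨?_, ?_⟩, fun t => U t - L t, 1 - α ^ K / 2, K, hDanti, hD0,
    by linarith, hcontr, fun t i => ?_⟩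
  · refine le_of_tendsto_of_tendsto' (tendsto_const_nhds (x := lo i))
      ((tendsto_const_nhds (x := ⨆ t, L t)).add hDlim) (fun t => ?_) |>.trans_eq (add_zero _)
    linarith [hloU t i, (hx t).1, (hx t).2]
  · refine le_of_tendsto_of_tendsto' ((tendsto_const_nhds (x := ⨆ t, L t)).sub hDlim)
      (tendsto_const_nhds (x := hi i)) (fun t => ?_) |>.trans' (sub_zero _).ge
    linarith [hLhi t i, (hx t).1, (hx t).2]
  · rw [abs_le]
    constructor <;> linarith [hvU t i, hLv t i, (hx t).1, (hx t).2]

/-! ### Consensus under summable perturbations -/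

/-- Averaging agents whose perturbations are at most `e t` converge to a common value. Summability
of `e` is expressed through a sequence `τ` that tends to `0` and dominates its tails. -/
theorem exists_perturbed_consensus [Nonempty (Fin N)] (hP : ConsensusWeights E P α T)
    {z : ℕ → Fin N → ℝ} {e τ : ℕ → ℝ}
    (hz : ∀ t i, |z (t + 1) i - ∑ j, P t i j * z t j| ≤ e t)
    (hτ : ∀ t, τ (t + 1) + e t ≤ τ t) (hτ0 : ∀ t, 0 ≤ τ t) (hτlim : Tendsto τ atTop (𝓝 0)) :
    ∃ x, ∀ i, Tendsto (fun t => z t i) atTop (𝓝 x) := by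
  let U : ℕ → ℝ := fun t => Finset.univ.sup' Finset.univ_nonempty fun i => z t i + τ t
  let L : ℕ → ℝ := fun t => Finset.univ.inf' Finset.univ_nonempty fun i => z t i - τ t
  have hzU : ∀ t i, z t i + τ t ≤ U t := fun t i =>
    Finset.le_sup' (fun i => z t i + τ t) (Finset.mem_univ i)
  have hLz : ∀ t i, L t ≤ z t i - τ t := fun t i =>
    Finset.inf'_le (fun i => z t i - τ t) (Finset.mem_univ i)
  have hup : ∀ t i, z (t + 1) i + τ (t + 1) ≤ ∑ j, P t i j * (z t j + τ t) := by
    intro t i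
    simp_rw [mul_add, Finset.sum_add_distrib, hP.sum_const]
    linarith [(abs_le.1 (hz t i)).2, hτ t]
  have hdown : ∀ t i, ∑ j, P t i j * (z t j - τ t) ≤ z (t + 1) i - τ (t + 1) := by
    intro t i
    simp_rw [mul_sub, Finset.sum_sub_distrib, hP.sum_const]
    linarith [(abs_le.1 (hz t i)).1, hτ t]
  have hLU : ∀ t, L t ≤ U t := fun t => by
    linarith [hLz t (Classical.arbitrary _), hzU t (Classical.arbitrary _), hτ0 t]
  have hUanti : Antitone U := antitone_nat_of_succ_le fun t =>
    Finset.sup'_le _ _ fun i _ => (hup t i).trans (hP.sum_le t i (hzU t))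
  have hLmono : Monotone L := monotone_nat_of_le_succ fun t =>
    Finset.le_inf' _ _ fun i _ => (hP.le_sum t i (hLz t)).trans (hdown t i)
  set K := (T + 1) * N with hK
  have hα0 : 0 < α ^ K := pow_pos hP.pos K
  have hcontr : ∀ t, U (t + K) - L (t + K) ≤
      (1 - α ^ K) * (U t - L t) + α ^ K * (2 * τ t) := by
    intro t
    obtain ⟨i, -, hi⟩ := Finset.exists_mem_eq_inf' Finset.univ_nonempty fun i => z t i - τ t
    change L t = _ at hi
    have h2 := hLmono (Nat.le_add_right t K)
    -- the lowest agent lies `U t - L t - 2 * τ t` below the maximum of the raised agents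
    have hδ : 0 ≤ U t - L t - 2 * τ t := by linarith [hzU t i]
    have h1 : U (t + K) ≤ U t - α ^ K * (U t - L t - 2 * τ t) :=
      Finset.sup'_le _ _ fun j _ =>
        hP.spread (u := fun t i => z t i + τ t) (fun t i => (hup t i).trans (le_max_left _ _)) hδ
          (hzU t) (fun _ => le_rfl) ⟨i, by linarith⟩ j
    linarith
  have hDlim : Tendsto (fun t => U t - L t) atTop (𝓝 0) :=
    tendsto_zero_of_antitone_of_contracting
      (fun s t hst => sub_le_sub (hUanti hst) (hLmono hst)) (fun t => sub_nonneg.2 (hLU t))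
      (q := 1 - α ^ K) (by linarith) hcontr
      (by simpa using (hτlim.const_mul 2).const_mul (α ^ K))
  have hx : ∀ t, (⨆ t, L t) ∈ Set.Icc (L t) (U t) := by
    simpa using hLmono.ciSup_mem_iInter_Icc_of_antitone hUanti hLU
  refine ⟨⨆ t, L t, fun i => tendsto_iff_dist_tendsto_zero.2 ?_⟩
  refine squeeze_zero (fun _ => dist_nonneg) (fun t => ?_) hDlim
  rw [Real.dist_eq, abs_le]
  constructor <;> linarith [hzU t i, hLz t i, (hx t).1, (hx t).2, hτ0 t]

/-- Agents `v` that average and then project onto closed intervals with a common point converge to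
a common value `x` of all the intervals, and agents that average and drift by the averaged `v`
follow a common uniform motion with velocity proportional to `x`. -/
theorem exists_double_consensus [Nonempty (Fin N)] (hP : ConsensusWeights E P α T)
    {v y : ℕ → Fin N → ℝ} {I : Fin N → Set ℝ} (hclosed : ∀ i, IsClosed (I i))
    (hconn : ∀ i, (I i).OrdConnected) {c : ℝ} (hc : ∀ i, c ∈ I i)
    (hvI : ∀ t i, v (t + 1) i ∈ I i)
    (hproj : ∀ t i, ∀ w ∈ I i,
      |∑ j, P t i j * v t j - v (t + 1) i| ≤ |∑ j, P t i j * v t j - w|)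
    {h : ℝ} (hh : 0 ≤ h)
    (hy : ∀ t i, y (t + 1) i = ∑ j, P t i j * y t j + h * ∑ j, P t i j * v t j) :
    ∃ x y₀, (∀ i, x ∈ I i) ∧ (∀ i, Tendsto (fun t => v t i - x) atTop (𝓝 0)) ∧
      ∀ i, Tendsto (fun t => y t i - (y₀ + h * t * x)) atTop (𝓝 0) := by
  -- the projection does not overshoot a point of the interval
  have hle : ∀ t i, ∀ w ∈ I i, v (t + 1) i ≤ max (∑ j, P t i j * v t j) w := by
    intro t i w hw
    by_contra! hcon
    obtain ⟨h1, h2⟩ := max_lt_iff.1 hcon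
    have hmem : max (∑ j, P t i j * v t j) w ∈ I i :=
      (hconn i).out hw (hvI t i) ⟨le_max_right _ _, hcon.le⟩
    have := hproj t i _ hmem
    rw [abs_of_neg (by linarith), abs_of_nonpos (by linarith [le_max_left (∑ j, P t i j * v t j) w])]
      at this
    linarith
  have hge : ∀ t i, ∀ w ∈ I i, min (∑ j, P t i j * v t j) w ≤ v (t + 1) i := by
    intro t i w hw
    by_contra! hcon
    obtain ⟨h1, h2⟩ := lt_min_iff.1 hcon
    have hmem : min (∑ j, P t i j * v t j) w ∈ I i :=
      (hconn i).out (hvI t i) hw ⟨hcon.le, min_le_right _ _⟩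
    have := hproj t i _ hmem
    rw [abs_of_pos (by linarith), abs_of_nonneg (by linarith [min_le_left (∑ j, P t i j * v t j) w])]
      at this
    linarith
  obtain ⟨M, hMc, hM⟩ : ∃ M, c ≤ M ∧ ∀ i, v 0 i ≤ M := by
    obtain ⟨M, hM⟩ := (Set.finite_range (v 0)).bddAbove
    exact ⟨max c M, le_max_left _ _, fun i => (hM ⟨i, rfl⟩).trans (le_max_right _ _)⟩
  obtain ⟨m, hmc, hm⟩ : ∃ m, m ≤ c ∧ ∀ i, m ≤ v 0 i := by
    obtain ⟨m, hm⟩ := (Set.finite_range (v 0)).bddBelow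
    exact ⟨min c m, min_le_left _ _, fun i => (min_le_right _ _).trans (hm ⟨i, rfl⟩)⟩
  have hbound : ∀ t i, v t i ∈ Set.Icc m M := by
    intro t
    induction t with
    | zero => exact fun i => ⟨hm i, hM i⟩
    | succ t ih =>
      exact fun i => ⟨(le_min (hP.le_sum t i fun j => (ih j).1) hmc).trans (hge t i c (hc i)),
        (hle t i c (hc i)).trans (max_le (hP.sum_le t i fun j => (ih j).2) hMc)⟩
  -- since `v` stays in `[m, M]`, the intervals may be cut off there, which gives them endpoints
  have hcpt : ∀ i, IsCompact (I i ∩ Set.Icc m M) := fun i => isCompact_Icc.inter_left (hclosed i)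
  have hne : ∀ i, (I i ∩ Set.Icc m M).Nonempty := fun i => ⟨c, hc i, hmc, hMc⟩
  choose lo hlo using fun i => (hcpt i).exists_isLeast (hne i)
  choose hi hhi using fun i => (hcpt i).exists_isGreatest (hne i)
  obtain ⟨x, hx, D, q, K, hDanti, hD0, hq, hDK, hvD⟩ :=
    hP.exists_constrained_consensus (v := v) (lo := lo) (hi := hi)
      (fun i j => ((hlo i).2 ⟨hc i, hmc, hMc⟩).trans ((hhi j).2 ⟨hc j, hmc, hMc⟩))
      (fun t i => hle t i _ (hlo i).1.1) (fun t i => hge t i _ (hhi i).1.1)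
      (fun t i => ⟨(hlo i).2 ⟨hvI t i, hbound _ i⟩, (hhi i).2 ⟨hvI t i, hbound _ i⟩⟩)
  have hDlim : Tendsto D atTop (𝓝 0) := tendsto_zero_of_antitone_of_contracting hDanti hD0 hq
    (fun t => (hDK t).trans_eq (add_zero _).symm) tendsto_const_nhds
  have hq' : 0 < 1 - q := sub_pos.2 hq
  -- a sum over one contraction window dominates the tail: its increments telescope
  obtain ⟨y₀, hy₀⟩ := hP.exists_perturbed_consensus (z := fun t i => y t i - h * t * x)
    (e := fun t => h * D t) (τ := fun t => h / (1 - q) * ∑ k ∈ Finset.range K, D (t + k))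
    (fun t i => by
      have h1 : y (t + 1) i - h * ((t + 1 : ℕ) : ℝ) * x - ∑ j, P t i j * (y t j - h * t * x)
          = h * ∑ j, P t i j * (v t j - x) := by
        simp_rw [mul_sub (P t i _), Finset.sum_sub_distrib, hP.sum_const, hy]
        push_cast
        ring
      rw [h1, abs_mul, abs_of_nonneg hh]
      refine mul_le_mul_of_nonneg_left (abs_le.2 ⟨?_, ?_⟩) hh
      · exact hP.le_sum t i fun j => (abs_le.1 (hvD t j)).1
      · exact hP.sum_le t i fun j => (abs_le.1 (hvD t j)).2)
    (fun t => by
      have h1 : ∑ k ∈ Finset.range K, D (t + 1 + k) + D t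
          = ∑ k ∈ Finset.range K, D (t + k) + D (t + K) := by
        rw [← Finset.sum_range_succ (fun k => D (t + k)), Finset.sum_range_succ']
        simp only [add_zero, add_assoc, add_comm 1]
      have h2 : h / (1 - q) * ((1 - q) * D t) = h * D t := by field_simp
      rw [← h2, ← mul_add]
      refine mul_le_mul_of_nonneg_left ?_ (div_nonneg hh hq'.le)
      linarith [hDK t])
    (fun t => mul_nonneg (div_nonneg hh hq'.le) (Finset.sum_nonneg fun k _ => hD0 _))
    (by
      have : Tendsto (fun t => ∑ k ∈ Finset.range K, D (t + k)) atTop (𝓝 0) := by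
        simpa using tendsto_finsetSum (Finset.range K) fun k _ =>
          hDlim.comp (tendsto_add_atTop_nat k)
      simpa using this.const_mul (h / (1 - q)))
  refine ⟨x, y₀, fun i => (hconn i).out (hlo i).1.1 (hhi i).1.1 (hx i), fun i => ?_, fun i => ?_⟩
  · exact squeeze_zero_norm (fun t => hvD t i) hDlim
  · have := (hy₀ i).sub_const y₀
    rw [sub_self] at this
    refine this.congr fun t => ?_
    ring

end ConsensusWeights

/-! ### The communication matrix, the reference sets and the projection -/

theorem sum_commMatrix_mul {N : ℕ} (E : Set (Fin N × Fin N)) (a : Fin N → Fin N → ℝ) (i : Fin N)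
    (f : Fin N → ℝ) :
    ∑ j, commMatrix E a i j * f j = f i + ∑ j ∈ neighbors E i, a i j * (f j - f i) := by
  classical
  have h1 : ∀ j, commMatrix E a i j * f j =
      (if i = j then (1 - ∑ k ∈ neighbors E i, a i k) * f j else 0) +
        if (i, j) ∈ E ∧ i ≠ j then a i j * f j else 0 := by
    intro j
    simp only [commMatrix, Matrix.of_apply]
    by_cases hij : i = j
    · simp [hij]
    · by_cases hE : (i, j) ∈ E <;> simp [hij, hE]
  have h2 : ∑ j, (if (i, j) ∈ E ∧ i ≠ j then a i j * f j else 0)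
      = ∑ j ∈ neighbors E i, a i j * f j := by
    rw [neighbors, Finset.sum_filter]
  rw [Finset.sum_congr rfl fun j _ => h1 j, Finset.sum_add_distrib, h2, Finset.sum_ite_eq,
    if_pos (Finset.mem_univ i)]
  simp_rw [mul_sub, Finset.sum_sub_distrib, ← Finset.sum_mul]
  ring

theorem WeightsBounded.consensusWeights {N : ℕ} [Nonempty (Fin N)] {E : ℕ → Set (Fin N × Fin N)}
    {a : ℕ → Fin N → Fin N → ℝ} {abar : ℝ} (hw : WeightsBounded E a abar) (h0 : 0 < abar) {T : ℕ}
    (hT : ∀ t, StronglyConnected (⋃ k ∈ Set.Icc t (t + T), E k)) :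
    ConsensusWeights E (fun t => commMatrix (E t) (a t)) abar T where
  pos := h0
  le_one := by
    have h := hw 0 (Classical.arbitrary _) (Classical.arbitrary _)
    exact (h.2 (Or.inr rfl)).le.trans h.1
  nonneg t i j := by
    by_cases hij : (i, j) ∈ E t ∨ i = j
    · exact (h0.trans ((hw t i j).2 hij)).le
    · push Not at hij
      simp [commMatrix, hij.1, hij.2]
  row_sum t i := by simpa using sum_commMatrix_mul (E t) (a t) i 1
  le_diag t i := ((hw t i i).2 (Or.inr rfl)).le
  le_edge t i j hij := ((hw t i j).2 (Or.inl hij)).le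
  conn := hT

theorem IsTruncatedRefSet.exists_interval {ε : ℝ} {W : Set RefSpace} (hW : IsTruncatedRefSet ε W) :
    ∃ I : Set ℝ, IsClosed I ∧ I.OrdConnected ∧ W = {w | w 1 ∈ I} := by
  rcases hW with ⟨l, Hw, rfl⟩ | ⟨lo, up, rfl⟩
  · refine ⟨⋂ k, {x | Hw k * x ≤ 1 - ε}, ?_, ?_, ?_⟩
    · exact isClosed_iInter fun k => isClosed_le (by fun_prop) continuous_const
    · refine Set.ordConnected_iInter fun k => ⟨fun x hx y hy z hz => ?_⟩
      simp only [Set.mem_ofPred_eq] at hx hy ⊢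
      rcases le_total 0 (Hw k) with h | h
      · exact (mul_le_mul_of_nonneg_left hz.2 h).trans hy
      · exact (mul_le_mul_of_nonpos_left hz.1 h).trans hx
    · ext w
      simp [refSetOfRows]
  · exact ⟨Set.Icc (lo + ε) (up - ε), isClosed_Icc, Set.ordConnected_Icc, rfl⟩

/-- Projecting onto a horizontal strip keeps the first coordinate and projects the second one. -/
theorem IsProj.coordinates {I : Set ℝ} {μ p : RefSpace} (hp : IsProj {w | w 1 ∈ I} μ p) :
    p 0 = μ 0 ∧ p 1 ∈ I ∧ ∀ w ∈ I, |μ 1 - p 1| ≤ |μ 1 - w| := by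
  obtain ⟨hpI, hmin⟩ := hp
  have key : ∀ w ∈ I, (μ 0 - p 0) ^ 2 + (μ 1 - p 1) ^ 2 ≤ (μ 1 - w) ^ 2 := by
    intro w hw
    have := hmin (show !₂[μ 0, w] ∈ {w : RefSpace | w 1 ∈ I} from hw)
    simpa [EuclideanSpace.norm_sq_eq, Fin.sum_univ_two] using this
  refine ⟨?_, hpI, fun w hw => sq_le_sq.1 ?_⟩
  · have := key _ hpI
    have h0 : (μ 0 - p 0) ^ 2 = 0 := le_antisymm (by linarith) (sq_nonneg _)
    exact (sub_eq_zero.1 (pow_eq_zero_iff two_ne_zero |>.1 h0)).symm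
  · exact (le_add_of_nonneg_left (sq_nonneg _)).trans (key w hw)

theorem refModel_apply_zero (h : ℝ) (w : RefSpace) : refModel h w 0 = w 0 + h * w 1 := by
  simp [refModel, Matrix.toLpLin_apply, dotProduct, Fin.sum_univ_two]

theorem refModel_apply_one (h : ℝ) (w : RefSpace) : refModel h w 1 = w 1 := by
  simp [refModel, Matrix.toLpLin_apply, dotProduct, Fin.sum_univ_two]

/-! ### Consensus on a trajectory of the reference model -/

theorem lemma5 {N : ℕ} (E : ℕ → Set (Fin N × Fin N)) (a : ℕ → Fin N → Fin N → ℝ)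
    (abar : ℝ) (h_abar : 0 < abar) (h_weights : WeightsBounded E a abar)
    (h_conn : UniformlyStronglyConnected E)
    (h : ℝ) (h_pos : 0 < h)
    (ε : ℝ) (h_eps : 0 < ε)
    (W : Fin N → Set RefSpace) (h_W : ∀ i, IsTruncatedRefSet ε (W i))
    (h_nonempty : (⋂ i, W i).Nonempty)
    (ω : ℕ → Fin N → RefSpace)
    (h_update : ∀ t i, IsProj (W i)
      (refModel h (ω t i + ∑ j ∈ neighbors (E t) i, a t i j • (ω t j - ω t i)))
      (ω (t + 1) i)) :
    ∃ ωbar : ℕ → RefSpace,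
      (∀ t, ωbar (t + 1) = refModel h (ωbar t)) ∧
      (∀ t, ωbar t ∈ ⋂ i, W i) ∧
      ∀ i, Tendsto (fun t => ω t i - ωbar t) atTop (𝓝 0) := by

  rcases isEmpty_or_nonempty (Fin N) with hN | hN
  · exact ⟨fun _ => 0, fun _ => by simp, fun _ => by simp, fun i => hN.elim i⟩
  obtain ⟨T, -, hT⟩ := h_conn
  have hP := h_weights.consensusWeights h_abar hT
  choose I hclosed hconn hWI using fun i => (h_W i).exists_interval
  obtain ⟨w, hw⟩ := h_nonempty
  have hc : ∀ i, w 1 ∈ I i := fun i => by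
    have := Set.mem_iInter.1 hw i
    rwa [hWI] at this
  have hcoord : ∀ t i k,
      (ω t i + ∑ j ∈ neighbors (E t) i, a t i j • (ω t j - ω t i)) k
        = ∑ j, commMatrix (E t) (a t) i j * ω t j k := by
    intro t i k
    rw [sum_commMatrix_mul]
    simp
  have hupd := fun t i => (hWI i ▸ h_update t i).coordinates
  simp only [refModel_apply_zero, refModel_apply_one, hcoord] at hupd
  obtain ⟨x, y₀, hx, hv, hy⟩ := hP.exists_double_consensus
    (v := fun t i => ω t i 1) (y := fun t i => ω t i 0) hclosed hconn hc
    (fun t i => (hupd t i).2.1) (fun t i => (hupd t i).2.2) h_pos.le (fun t i => (hupd t i).1)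
  refine ⟨fun t => !₂[y₀ + h * t * x, x], fun t => ?_, fun t => ?_, fun i => ?_⟩
  · ext k
    fin_cases k
    · change _ = refModel h _ 0
      rw [refModel_apply_zero]
      simp
      ring
    · change _ = refModel h _ 1
      rw [refModel_apply_one]
      simp
  · exact Set.mem_iInter.2 fun i => by rw [hWI]; exact hx i
  · have hsum : Tendsto (fun t => |ω t i 0 - (y₀ + h * t * x)| + |ω t i 1 - x|) atTop (𝓝 0) := by
      simpa using (hy i).abs.add (hv i).abs
    refine squeeze_zero_norm (fun t => ?_) hsum
    refine abs_le_of_sq_le_sq' ?_ (by positivity) |>.2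
    rw [EuclideanSpace.norm_sq_eq, Fin.sum_univ_two]
    simp only [PiLp.sub_apply, Real.norm_eq_abs]
    change |ω t i 0 - (y₀ + h * t * x)| ^ 2 + |ω t i 1 - x| ^ 2 ≤ _
    nlinarith [mul_nonneg (abs_nonneg (ω t i 0 - (y₀ + h * t * x))) (abs_nonneg (ω t i 1 - x))]
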